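/- Let $\kappa>2$ and $\sigma>0$. There is a constant $C>0$ depending only on $\kappa$ and $\sigma$ such that the following holds for every finite wireless network with uniform power. **Network.** A finite set $V$ of nodes in the Euclidean plane and a set $E$ of directed links (sender, receiver), all transmitting at the same power $P>0$, with reference loss factor $\eta>0$, noise $\xi>0$, path-loss exponent $\kappa$, and link lengths $\|l\|$ satisfying $0<r\le\|l\|\le R$ and $\|l\|<(\eta P/(\sigma\xi))^{1/\kappa}$. A set $S\subseteq E$ is independent (an ISL) if for every $l=(u,v)\in S$ $$\frac{P\eta\|uv\|^{-\kappa}}{\xi+\sum_{(u',v')\in S\setminus\{l\}}P\eta\|u'v\|^{-\kappa}}\ge\sigma .$$ With $c_l=\sigma/(1-\sigma\xi/(P\eta\|l\|^{-\kappa}))$, the affectness of $l=(u,v)$ caused by $S$ is $a_S(l)=c_l\sum_{(u',v')\in S\setminus\{l\}}\|u'v\|^{-\kappa}/\|uv\|^{-\kappa}$. (A received power at distance $0$ counts as infinite.) **Local link sets.** Cut the plane into cells of side $R$, the cell with index $(x,y)$ being $(xR,(x+1)R]\times(yR,(y+1)R]$. Let $K=2M+J$ with integers $M,J\ge 0$,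 and let $0\le a,b<K$ be integer shifts. For integers $i,j$, $L_{ij}$ is the set of links with both ends in the cells with index $(x,y)$, $iK+a+M\le x<(i+1)K+a-M$, $jK+b+M\le y<(j+1)K+b-M$. **Local schedule.** Let $Q\ge 0$ be weights (queue lengths) on the links, $W(S)=\sum_{l\in S}Q_l$, and $0<\varepsilon<1$. The local schedule $\mathcal X_{ij}$ is computed from $L_{ij}$ as follows, ties being broken arbitrarily. (1) With $n=|L_{ij}|$ and $w_{\max}$ the maximum weight in $L_{ij}$, remove the links of weight less than $w_{\max}/n$; let $w_{\min}$ be the minimum remaining weight. (2) For each $k\ge 0$ let $G_k$ be the set of remaining links of weight in $[2^kw_{\min},2^{k+1}w_{\min})$, and select a subset of $G_k$ greedily: repeatedly select a shortest remaining link $a$ of $G_k$, and discard $a$, all links of $G_k$ whose sender is within distance $\bigl(1+(2c_a(16\zeta(\kappa-1)+8\zeta(\kappa)))^{1/\kappa}\bigr)\|a\|$ of the sender of $a$, and all links on which the links selected so far cause an affectness greater than $1/2$; here $\zeta$ is the Riemann zeta function. Let $X_0$ be a heaviest one of the sets selected from the groups. (3) List the links of $X_0$ in some order. Put them one after the other into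 the first class whose links cause an affectness of at most $(1-\varepsilon)/2$ on the new link (opening a new class if there is none), and split each class again by the same procedure in the reverse order; every final class then has affectness at most $1-\varepsilon$ on each of its links. $\mathcal X_{ij}$ is a heaviest final class (or the empty set, which is always available). **Claim.** Let $S^*$ be a maximum-weight independent set of links (MWISL) of the whole network. Then every local schedule $\mathcal X_{ij}$ so computed satisfies $$W(\mathcal X_{ij})\ \ge\ \frac{(1-\varepsilon)^2}{4\,C\log|V|}\;W(S^*\cap L_{ij}).$$ (If $|V|\le 1$ there are no links, and both weights are $0$.) -/

import Mathlib

open scoped ENNReal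

noncomputable section

/-- A wireless network in the Euclidean plane under the physical interference model with uniform
transmission power `P`, path-loss exponent `κ` and SINR threshold `σ`.  `loc` gives the positions
of the nodes, and a link is an ordered pair (sender, receiver). -/
structure WirelessNetwork (κ σ : ℝ) (V : Type*) where
  loc : V → EuclideanSpace ℝ (Fin 2)
  /-- the set of links -/
  E : Finset (V × V)
  /-- the common transmission power -/
  P : ℝ
  /-- the reference loss factor -/
  η : ℝ
  /-- the ambient noise -/
  ξ : ℝ
  /-- lower and upper bounds for the link lengths -/
  r : ℝ
  R : ℝ
  P_pos : 0 < P
  η_pos : 0 < η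
  ξ_pos : 0 < ξ
  r_pos : 0 < r
  r_le_R : r ≤ R
  r_le_length : ∀ l ∈ E, r ≤ dist (loc l.1) (loc l.2)
  length_le_R : ∀ l ∈ E, dist (loc l.1) (loc l.2) ≤ R
  /-- all links are shorter than the maximum transmission radius -/
  length_lt_radius : ∀ l ∈ E, dist (loc l.1) (loc l.2) < (η * P / (σ * ξ)) ^ (1 / κ)

namespace WirelessNetwork

variable {κ σ : ℝ} {V : Type*} (N : WirelessNetwork κ σ V)

/-! ### The physical interference model -/

/-- The length of a link. -/
def length (l : V × V) : ℝ := dist (N.loc l.1) (N.loc l.2)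

/-- The power received at node `v` from a transmission of node `u`, that is `P η ‖uv‖ ^ (-κ)`.
It is infinite if `u` and `v` are at the same place (a transmitting node cannot receive). -/
def received (u v : V) : ℝ≥0∞ :=
  ENNReal.ofReal (N.P * N.η) * edist (N.loc u) (N.loc v) ^ (-κ)

open scoped Classical in
/-- The SINR of the link `l` when exactly the links in `S` transmit. -/
def sinr (S : Finset (V × V)) (l : V × V) : ℝ≥0∞ :=
  N.received l.1 l.2 / (∑ l' ∈ S.erase l, N.received l'.1 l.2 + ENNReal.ofReal N.ξ)

/-- Feasible schedules, i.e. independent sets of links (ISL). -/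
def IsISL (S : Finset (V × V)) : Prop :=
  S ⊆ N.E ∧ ∀ l ∈ S, ENNReal.ofReal σ ≤ N.sinr S l

/-- The total weight of a set of links. -/
def weight (Q : V × V → ℝ) (S : Finset (V × V)) : ℝ := ∑ l ∈ S, Q l

/-- `S` is a maximum weighted independent set of links (MWISL) of the whole network. -/
def IsMWISL (Q : V × V → ℝ) (S : Finset (V × V)) : Prop :=
  N.IsISL S ∧ ∀ T, N.IsISL T → weight Q T ≤ weight Q S

open scoped Classical in
/-- The relative interference of the link `l'` on the link `l`. -/
def relInterference (l' l : V × V) : ℝ≥0∞ :=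
  if l' = l then 0 else N.received l'.1 l.2 / N.received l.1 l.2

/-- The constant `c_l = σ / (1 - σ ξ / (P η ‖l‖ ^ (-κ)))`. -/
def noiseFactor (l : V × V) : ℝ :=
  σ / (1 - σ * N.ξ / (N.P * N.η * N.length l ^ (-κ)))

/-- The affectness of the link `l` caused by the set `S` of links.  (A `p`-signal set is a set `S`
with `N.affectness S l ≤ 1 / p` for all `l ∈ S`.) -/
def affectness (S : Finset (V × V)) (l : V × V) : ℝ≥0∞ :=
  ENNReal.ofReal (N.noiseFactor l) * ∑ l' ∈ S, N.relInterference l' l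

/-! ### Partition of the plane -/

/-- The integer `i` with `i * R < x ≤ (i + 1) * R`: the index of the strip of width `R` that
contains the coordinate `x`. -/
def stripIndex (x : ℝ) : ℤ := ⌈x / N.R⌉ - 1

/-- The node `v` lies in sub-square `(i, j)` of the partition with super-sub-square side `K` (in
cells), margin `M` and shifts `a`, `b`. -/
def InSubSquare (K M a b : ℕ) (i j : ℤ) (v : V) : Prop :=
  N.stripIndex (N.loc v 0) ∈ Set.Ico (i * K + a + M) ((i + 1) * K + a - M) ∧
  N.stripIndex (N.loc v 1) ∈ Set.Ico (j * K + b + M) ((j + 1) * K + b - M)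

open scoped Classical in
/-- `L_ij`: the links with both ends inside sub-square `(i, j)`. -/
def localLinks (K M a b : ℕ) (i j : ℤ) : Finset (V × V) :=
  N.E.filter fun l => N.InSubSquare K M a b i j l.1 ∧ N.InSubSquare K M a b i j l.2

open scoped Classical in
/-- The links of `S` that belong to `L_ij`. -/
def localPart (K M a b : ℕ) (i j : ℤ) (S : Finset (V × V)) : Finset (V × V) :=
  S ∩ N.localLinks K M a b i j

/-! ### Unweighted independent sets of links: greedy selection by increasing length -/

/-- The exclusion radius around the sender of a selected link `a`: `ρ_a ‖a‖`, where
`ρ_a = 1 + (2 c_a (16 ζ(κ - 1) + 8 ζ(κ))) ^ (1 / κ)`.  At most `16 k + 8` points with mutual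
distances at least `D` lie at a distance between `k D` and `(k + 1) D` of a given point, so links
that are all at least as long as `a` and whose senders keep these distances cause an affectness of
at most `1 / 2` on `a`. -/
def exclusionRadius (a : V × V) : ℝ :=
  (1 + (2 * N.noiseFactor a *
    ∑' k : ℕ, (16 * ((k : ℝ) + 1) + 8) * ((k : ℝ) + 1) ^ (-κ)) ^ (1 / κ)) * N.length a

open scoped Classical in
/-- `N.GreedyRun A I O`: starting from the candidate links `A` and the already selected links `I`,
the greedy algorithm may stop with the set `O` of selected links.  In each step it selects a shortest
candidate `a`, and then discards (`a` itself and) every candidate whose sender is within the exclusion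
radius of `a` or on which the links selected so far cause an affectness greater than `1 / 2`. -/
inductive GreedyRun : Finset (V × V) → Finset (V × V) → Finset (V × V) → Prop
  | nil (I : Finset (V × V)) : GreedyRun ∅ I I
  | step (A I O : Finset (V × V)) (a : V × V) (mem : a ∈ A)
      (shortest : ∀ b ∈ A, N.length a ≤ N.length b)
      (rest : GreedyRun
        (A.filter fun b => b ≠ a ∧ N.exclusionRadius a < dist (N.loc b.1) (N.loc a.1) ∧
          N.affectness (insert a I) b ≤ 1 / 2)
        (insert a I) O) :
      GreedyRun A I O

/-! ### Weighted independent sets of links: grouping by weight -/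

/-- Phase I: the links of `A` that remain when those of weight less than `w_max / n` are removed,
where `w_max` is the maximum weight and `n` the number of links in `A`. -/
def heavyLinks (Q : V × V → ℝ) (A : Finset (V × V)) : Finset (V × V) :=
  A.filter fun l => sSup (Q '' A) / (A.card : ℝ) ≤ Q l

/-- Phase II: the `k`-th group of remaining links, those with weight in
`[2 ^ k w_min, 2 ^ (k + 1) w_min)`, where `w_min` is the minimum weight of a remaining link. -/
def weightGroup (Q : V × V → ℝ) (A : Finset (V × V)) (k : ℕ) : Finset (V × V) :=
  (heavyLinks Q A).filter fun l =>
    2 ^ k * sInf (Q '' heavyLinks Q A) ≤ Q l ∧ Q l < 2 ^ (k + 1) * sInf (Q '' heavyLinks Q A)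

/-- `X` is a possible output of the algorithm for weighted independent sets of links on input `A`:
the greedy algorithm is run on each weight group, and a heaviest of the resulting sets is chosen. -/
def IsGroupedISL (Q : V × V → ℝ) (A X : Finset (V × V)) : Prop :=
  ∃ O : ℕ → Finset (V × V), (∀ k, N.GreedyRun (weightGroup Q A k) ∅ (O k)) ∧
    ∃ k, X = O k ∧ ∀ k', weight Q (O k') ≤ weight Q (O k)

/-! ### Refinement by first-fit -/

open scoped Classical in
/-- Put `l` into the first class whose links cause an affectness of at most `τ` on `l`; if there is
none, open a new class. -/
def firstFitInsert (τ : ℝ≥0∞) (l : V × V) : List (Finset (V × V)) → List (Finset (V × V))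
  | [] => [{l}]
  | B :: Bs => if N.affectness B l ≤ τ then insert l B :: Bs else B :: firstFitInsert τ l Bs

/-- First-fit: the links of a list are put into classes one after the other. -/
def firstFit (τ : ℝ≥0∞) (L : List (V × V)) : List (Finset (V × V)) :=
  L.foldl (fun classes l => N.firstFitInsert τ l classes) []

open scoped Classical in
/-- The refinement protocol for links listed in `L`: first-fit with tolerance `(1 - ε) / 2` in the
order of the list, and then, inside each resulting class, first-fit with the same tolerance in the
reverse order.  Thus every final class has affectness at most `1 - ε` on each of its links. -/
def refine (ε : ℝ) (L : List (V × V)) : List (Finset (V × V)) :=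
  (N.firstFit (ENNReal.ofReal ((1 - ε) / 2)) L).flatMap fun B =>
    N.firstFit (ENNReal.ofReal ((1 - ε) / 2)) (L.reverse.filter fun l => l ∈ B)

/-- `X` is a possible local schedule computed from the link set `A` with the weights `Q`: an
independent set of links `X₀ ⊆ A` is computed, its links are listed in some order and refined into
sets of affectness at most `1 - ε`, and `X` is a heaviest one of these (the empty schedule being
always available). -/
def IsLocalSchedule (Q : V × V → ℝ) (ε : ℝ) (A X : Finset (V × V)) : Prop :=
  ∃ (X₀ : Finset (V × V)) (L : List (V × V)),
    N.IsGroupedISL Q A X₀ ∧ L.Nodup ∧ (∀ l, l ∈ L ↔ l ∈ X₀) ∧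
    X ∈ ∅ :: N.refine ε L ∧ ∀ Y ∈ ∅ :: N.refine ε L, weight Q Y ≤ weight Q X

end WirelessNetwork

end

noncomputable section

/-! Rearranging the SINR condition shows that every link of an independent set has affectness at
most `1`, and this passes to subsets. It thus suffices to compare the heaviest final class with an
arbitrary set `T` of local links of affectness at most `1`. Three losses multiply.

Greedy selection loses a constant in cardinality (`GreedyRun.card_le`). A link of `T` discarded for
proximity is charged to a selected link that is no longer than it; each selected link is charged
boundedly often, since crowded senders affect each other strongly (`card_near_le`). The links of `T`
affected by more than `1 / 2` by the output `O` number at most a constant times `O.card`: surround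
every sender of `O` by its nearest senders of `T` as guards. A link that is neither a guard nor too
close to `O` is affected by the guards about as much as by `O`, multiplied by the number of guards
per sender, which contradicts affectness at most `1` (`exists_guarded_subset`, `card_affected_le`).

Grouping by weight loses a factor logarithmic in the number of links: inside a group weights agree
up to a factor `2`, logarithmically many groups cover the heavy links, and the light links together
weigh no more than one heaviest link (`weight_le_of_isGroupedISL`).

Refinement loses a constant over `(1 - ε) ^ 2`. Greedy output has bounded affectness, as earlier
links contribute at most `1 / 2` and later ones are separated, so that a convergent lattice sum
bounds them (`GreedyRun.affectness_le`). Hence each of the two first-fit passes opens few classes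
(`length_firstFit_le`). -/

/-! ### Nearest elements of a finite set, and packing in the plane. -/

lemma Finset.exists_subset_card_eq_forall_le {α : Type*} [DecidableEq α] (s : Finset α)
    (f : α → ℝ) {n : ℕ} (hn : n ≤ s.card) :
    ∃ t ⊆ s, t.card = n ∧ ∀ x ∈ t, ∀ y ∈ s \ t, f x ≤ f y := by
  induction n with
  | zero => exact ⟨∅, by simp⟩
  | succ n ih =>
    obtain ⟨t, hts, hcard, ht⟩ := ih (by omega)
    have hne : (s \ t).Nonempty := by
      rw [← Finset.card_pos, Finset.card_sdiff_of_subset hts]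
      omega
    obtain ⟨a, ha, hmin⟩ := (s \ t).exists_min_image f hne
    rw [Finset.mem_sdiff] at ha
    refine ⟨insert a t, Finset.insert_subset ha.1 hts, by simp [ha.2, hcard], fun x hx y hy => ?_⟩
    simp only [Finset.mem_sdiff, Finset.mem_insert, not_or] at hy
    rcases Finset.mem_insert.1 hx with rfl | hx
    · exact hmin y (by simp [hy])
    · exact ht x hx y (by simp [hy])

/-- Separated points in the plane can be matched with nonzero lattice points that are, up to a
constant factor, at least as close to the origin. -/
lemma exists_lattice_points_of_separated {ι : Type*} (F : Finset ι)
    (p : ι → EuclideanSpace ℝ (Fin 2)) (q : EuclideanSpace ℝ (Fin 2)) {t : ℝ} (ht : 0 < t)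
    (hq : ∀ l ∈ F, t < dist (p l) q)
    (hp : ∀ l ∈ F, ∀ l' ∈ F, l ≠ l' → t < dist (p l) (p l')) :
    ∃ x : ι → Fin 2 → ℤ, Set.InjOn x F ∧
      ∀ l ∈ F, 0 < ‖x l‖ ∧ t / 4 * ‖x l‖ ≤ dist (p l) q := by
  -- The diagonal of a square of side `t / 2` is `t / √2 < t`, so rounding at mesh `t / 2` separates
  -- the points from each other and from `q`.
  have key : ∀ z w : EuclideanSpace ℝ (Fin 2), (∀ i, |z i - w i| ≤ t / 2) → dist z w < t := by
    intro z w h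
    rw [EuclideanSpace.dist_eq, Fin.sum_univ_two, Real.sqrt_lt' ht]
    simp only [Real.dist_eq]
    have h0 := h 0
    have h1 := h 1
    have := abs_nonneg (z 0 - w 0)
    have := abs_nonneg (z 1 - w 1)
    nlinarith
  have hcoord : ∀ (z w : EuclideanSpace ℝ (Fin 2)) (i : Fin 2), |z i - w i| ≤ dist z w := by
    intro z w i
    rw [dist_eq_norm]
    simpa [Real.norm_eq_abs] using PiLp.norm_apply_le (z - w) i
  refine ⟨fun l i => round ((p l i - q i) / (t / 2)), ?_, ?_⟩
  · intro l hl l' hl' h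
    by_contra hne
    refine absurd (key (p l) (p l') fun i => ?_) (hp l hl l' hl' hne).not_gt
    have hi : round ((p l i - q i) / (t / 2)) = round ((p l' i - q i) / (t / 2)) := congrFun h i
    have h1 := abs_le.1 (abs_sub_round ((p l i - q i) / (t / 2)))
    have h2 := abs_le.1 (abs_sub_round ((p l' i - q i) / (t / 2)))
    rw [hi] at h1
    have h3 : p l i - p l' i = t / 2 * ((p l i - q i) / (t / 2) - (p l' i - q i) / (t / 2)) := by
      field_simp; ring
    rw [h3, abs_mul, abs_of_pos (by positivity)]
    have h4 : |(p l i - q i) / (t / 2) - (p l' i - q i) / (t / 2)| ≤ 1 := by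
      rw [abs_le]; constructor <;> linarith
    nlinarith
  · intro l hl
    constructor
    · rw [norm_pos_iff]
      intro h
      refine absurd (key (p l) q fun i => ?_) (hq l hl).not_gt
      have hi : round ((p l i - q i) / (t / 2)) = 0 := congrFun h i
      have h1 := abs_sub_round ((p l i - q i) / (t / 2))
      rw [hi, Int.cast_zero, sub_zero, abs_div, abs_of_pos (show 0 < t / 2 by positivity),
        div_le_iff₀ (by positivity)] at h1
      linarith
    · have hd := hq l hl
      rw [← le_div_iff₀' (by positivity), pi_norm_le_iff_of_nonneg (by positivity)]
      intro i
      have h1 := abs_sub_round ((p l i - q i) / (t / 2))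
      have h2 := hcoord (p l) q i
      rw [Int.norm_eq_abs, le_div_iff₀ (by positivity)]
      -- After scaling by `t / 4` the rounding error costs `t / 8` and the main term half the
      -- distance; the error is absorbed since the distance exceeds `t`.
      have h3 : |((round ((p l i - q i) / (t / 2)) : ℤ) : ℝ)| ≤
          1 / 2 + |p l i - q i| / (t / 2) := by
        have h4 := abs_sub_abs_le_abs_sub ((round ((p l i - q i) / (t / 2)) : ℤ) : ℝ)
          ((p l i - q i) / (t / 2))
        rw [abs_sub_comm, abs_div (p l i - q i), abs_of_pos (show 0 < t / 2 by positivity)] at h4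
        linarith
      have h5 : |p l i - q i| / (t / 2) * (t / 4) = |p l i - q i| / 2 := by
        field_simp; norm_num
      nlinarith

namespace WirelessNetwork

variable {κ σ : ℝ} {V : Type*} (N : WirelessNetwork κ σ V)

/-! ### Link lengths and noise factors -/

lemma length_pos {l : V × V} (hl : l ∈ N.E) : 0 < N.length l :=
  N.r_pos.trans_le (N.r_le_length l hl)

lemma noise_lt_received (hκ : 0 < κ) (hσ : 0 < σ) {l : V × V} (hl : l ∈ N.E) :
    σ * N.ξ < N.P * N.η * N.length l ^ (-κ) := by
  have h0 := N.length_pos hl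
  have h1 : N.length l ^ κ < N.η * N.P / (σ * N.ξ) := by
    have h := N.length_lt_radius l hl
    rw [one_div] at h
    exact (Real.lt_rpow_inv_iff_of_pos h0.le
      (by have := N.η_pos; have := N.P_pos; have := N.ξ_pos; positivity) hκ).1 h
  have hξ := N.ξ_pos
  rw [lt_div_iff₀ (by positivity)] at h1
  have h2 : 0 < N.length l ^ κ := Real.rpow_pos_of_pos h0 _
  rw [Real.rpow_neg h0.le, ← div_eq_mul_inv, lt_div_iff₀ h2]
  linarith

lemma noise_ratio_mem (hκ : 0 < κ) (hσ : 0 < σ) {l : V × V} (hl : l ∈ N.E) :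
    0 < σ * N.ξ / (N.P * N.η * N.length l ^ (-κ)) ∧
      σ * N.ξ / (N.P * N.η * N.length l ^ (-κ)) < 1 := by
  have h := N.noise_lt_received hκ hσ hl
  have hξ := N.ξ_pos
  have h1 : 0 < σ * N.ξ := by positivity
  exact ⟨div_pos h1 (h1.trans h), (div_lt_one (h1.trans h)).2 h⟩

lemma le_noiseFactor (hκ : 0 < κ) (hσ : 0 < σ) {l : V × V} (hl : l ∈ N.E) :
    σ ≤ N.noiseFactor l := by
  obtain ⟨h0, h1⟩ := N.noise_ratio_mem hκ hσ hl
  rw [noiseFactor, le_div_iff₀ (by linarith)]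
  nlinarith

lemma noiseFactor_mono (hκ : 0 < κ) (hσ : 0 < σ) {l l' : V × V} (hl : l ∈ N.E) (hl' : l' ∈ N.E)
    (h : N.length l ≤ N.length l') : N.noiseFactor l ≤ N.noiseFactor l' := by
  obtain ⟨_, h1⟩ := N.noise_ratio_mem hκ hσ hl'
  have hP := N.P_pos
  have hη := N.η_pos
  have hξ := N.ξ_pos
  have h0 := N.length_pos hl
  have hpow : N.length l' ^ (-κ) ≤ N.length l ^ (-κ) :=
    Real.rpow_le_rpow_of_nonpos h0 h (by linarith)
  have hpos : 0 < N.length l' ^ (-κ) := Real.rpow_pos_of_pos (N.length_pos hl') _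
  unfold noiseFactor
  apply div_le_div_of_nonneg_left hσ.le (by linarith)
  gcongr

/-- The sum `16 ζ(κ - 1) + 8 ζ(κ)` that enters the exclusion radius. -/
def packingSum (κ : ℝ) : ℝ := ∑' k : ℕ, (16 * ((k : ℝ) + 1) + 8) * ((k : ℝ) + 1) ^ (-κ)

lemma packingSum_pos (hκ : 2 < κ) : 0 < packingSum κ := by
  have h1 : Summable fun k : ℕ => ((k : ℝ) + 1) ^ (1 - κ) := by
    have := (summable_nat_add_iff 1).2 (Real.summable_nat_rpow.2 (show 1 - κ < -1 by linarith))
    exact_mod_cast this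
  have h2 : Summable fun k : ℕ => ((k : ℝ) + 1) ^ (-κ) := by
    have := (summable_nat_add_iff 1).2 (Real.summable_nat_rpow.2 (show -κ < -1 by linarith))
    exact_mod_cast this
  have h : Summable fun k : ℕ => (16 * ((k : ℝ) + 1) + 8) * ((k : ℝ) + 1) ^ (-κ) := by
    refine ((h1.mul_left 16).add (h2.mul_left 8)).congr fun k => ?_
    have : ((k : ℝ) + 1) ^ (1 - κ) = ((k : ℝ) + 1) * ((k : ℝ) + 1) ^ (-κ) := by
      rw [sub_eq_add_neg, Real.rpow_add (by positivity), Real.rpow_one]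
    rw [this]; ring
  exact h.tsum_pos (fun k => by positivity) 0 (by norm_num)

/-- The factor `(2 c_a (16 ζ(κ - 1) + 8 ζ(κ))) ^ (1 / κ)`: the excess of the exclusion radius of `a`
over the length of `a`, relative to that length. -/
def excessFactor (a : V × V) : ℝ := (2 * N.noiseFactor a * packingSum κ) ^ (1 / κ)

lemma exclusionRadius_eq (a : V × V) :
    N.exclusionRadius a = (1 + N.excessFactor a) * N.length a := rfl

lemma excessFactor_pos (hκ : 2 < κ) (hσ : 0 < σ) {a : V × V} (ha : a ∈ N.E) :
    0 < N.excessFactor a := by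
  have h1 := packingSum_pos hκ
  have h2 := hσ.trans_le (N.le_noiseFactor (by linarith) hσ ha)
  exact Real.rpow_pos_of_pos (by positivity) _

lemma excessFactor_rpow (hκ : 2 < κ) (hσ : 0 < σ) {a : V × V} (ha : a ∈ N.E) :
    N.excessFactor a ^ κ = 2 * N.noiseFactor a * packingSum κ := by
  have h1 := packingSum_pos hκ
  have h2 := hσ.trans_le (N.le_noiseFactor (by linarith) hσ ha)
  rw [excessFactor, one_div, Real.rpow_inv_rpow (by positivity) (by linarith)]

lemma exclusionRadius_pos (hκ : 2 < κ) (hσ : 0 < σ) {a : V × V} (ha : a ∈ N.E) :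
    0 < N.exclusionRadius a := by
  have := N.excessFactor_pos hκ hσ ha
  have := N.length_pos ha
  rw [exclusionRadius_eq]
  positivity

/-- A longer link receives less power, so noise takes a larger share and `noiseFactor` grows. Since
the greedy algorithm proceeds by increasing length, later exclusion radii are at least as large as
earlier ones. -/
lemma exclusionRadius_mono (hκ : 2 < κ) (hσ : 0 < σ) {a b : V × V} (ha : a ∈ N.E) (hb : b ∈ N.E)
    (h : N.length a ≤ N.length b) : N.exclusionRadius a ≤ N.exclusionRadius b := by
  have h0 := N.excessFactor_pos hκ hσ ha
  have h1 := N.length_pos ha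
  have h2 := packingSum_pos hκ
  have h3 := hσ.trans_le (N.le_noiseFactor (by linarith) hσ ha)
  have h4 := N.noiseFactor_mono (by linarith) hσ ha hb h
  have h5 : N.excessFactor a ≤ N.excessFactor b := by
    unfold excessFactor
    exact Real.rpow_le_rpow (by positivity) (by gcongr) (by positivity)
  rw [exclusionRadius_eq, exclusionRadius_eq]
  exact mul_le_mul (by gcongr) h h1.le (by linarith)

/-! ### Received powers and affectness -/

lemma received_ne_zero (hκ : 0 < κ) (u v : V) : N.received u v ≠ 0 := by
  have hP := N.P_pos
  have hη := N.η_pos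
  refine mul_ne_zero (by simpa using mul_pos hP hη) ?_
  rw [ENNReal.rpow_neg]
  exact ENNReal.inv_ne_zero.2 (ENNReal.rpow_ne_top_of_nonneg hκ.le (edist_ne_top _ _))

lemma received_eq_ofReal {u v : V} (h : 0 < dist (N.loc u) (N.loc v)) :
    N.received u v = ENNReal.ofReal (N.P * N.η * dist (N.loc u) (N.loc v) ^ (-κ)) := by
  have hP := N.P_pos
  have hη := N.η_pos
  rw [received, edist_dist, ENNReal.ofReal_rpow_of_pos h,
    ← ENNReal.ofReal_mul (by positivity)]

lemma received_link_ne_top {l : V × V} (hl : l ∈ N.E) : N.received l.1 l.2 ≠ ⊤ := by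
  rw [N.received_eq_ofReal (N.length_pos hl)]
  exact ENNReal.ofReal_ne_top

lemma received_le_of_dist_le (hκ : 0 < κ) {o s v : V} {D : ℝ} (hD : 0 < D)
    (h : dist (N.loc s) (N.loc v) ≤ D * dist (N.loc o) (N.loc v)) :
    N.received o v ≤ ENNReal.ofReal (D ^ κ) * N.received s v := by
  have h1 : edist (N.loc s) (N.loc v) ≤ ENNReal.ofReal D * edist (N.loc o) (N.loc v) := by
    rw [edist_dist, edist_dist, ← ENNReal.ofReal_mul hD.le]
    exact ENNReal.ofReal_le_ofReal h
  have h2 : edist (N.loc o) (N.loc v) ^ (-κ) ≤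
      ENNReal.ofReal (D ^ κ) * edist (N.loc s) (N.loc v) ^ (-κ) := by
    have h3 : (ENNReal.ofReal D * edist (N.loc o) (N.loc v)) ^ (-κ) ≤
        edist (N.loc s) (N.loc v) ^ (-κ) := by
      rw [ENNReal.rpow_neg, ENNReal.rpow_neg]
      exact ENNReal.inv_le_inv.2 (ENNReal.rpow_le_rpow h1 hκ.le)
    calc edist (N.loc o) (N.loc v) ^ (-κ)
        = ENNReal.ofReal (D ^ κ) *
            (ENNReal.ofReal D * edist (N.loc o) (N.loc v)) ^ (-κ) := by
          rw [ENNReal.mul_rpow_of_ne_top ENNReal.ofReal_ne_top (edist_ne_top _ _), ← mul_assoc,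
            ENNReal.ofReal_rpow_of_pos hD, ← ENNReal.ofReal_mul (by positivity),
            ← Real.rpow_add hD]
          simp
      _ ≤ _ := by gcongr
  calc N.received o v ≤ ENNReal.ofReal (N.P * N.η) *
        (ENNReal.ofReal (D ^ κ) * edist (N.loc s) (N.loc v) ^ (-κ)) := by
        unfold received; gcongr
    _ = _ := by rw [received, mul_left_comm]

lemma relInterference_self (l : V × V) : N.relInterference l l = 0 := by
  simp [relInterference]

lemma relInterference_of_ne {l l' : V × V} (h : l' ≠ l) :
    N.relInterference l' l = N.received l'.1 l.2 / N.received l.1 l.2 := by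
  simp [relInterference, h]

lemma relInterference_le_mul (hκ : 0 < κ) {o s b : V × V} (hs : s ≠ b) {D : ℝ} (hD : 0 < D)
    (h : dist (N.loc s.1) (N.loc b.2) ≤ D * dist (N.loc o.1) (N.loc b.2)) :
    N.relInterference o b ≤ ENNReal.ofReal (D ^ κ) * N.relInterference s b := by
  by_cases hob : o = b
  · simp [hob, relInterference_self]
  rw [relInterference_of_ne N hob, relInterference_of_ne N hs, ← mul_div_assoc]
  exact ENNReal.div_le_div_right (N.received_le_of_dist_le hκ hD h) _

lemma one_le_relInterference (hκ : 0 < κ) {s b : V × V} (hb : b ∈ N.E) (hs : s ≠ b) {D : ℝ}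
    (hD : 0 < D) (h : dist (N.loc s.1) (N.loc b.2) ≤ D * N.length b) :
    1 ≤ ENNReal.ofReal (D ^ κ) * N.relInterference s b := by
  rw [relInterference_of_ne N hs, ← mul_div_assoc, ENNReal.le_div_iff_mul_le
    (Or.inl (N.received_ne_zero hκ _ _)) (Or.inl (N.received_link_ne_top hb)), one_mul]
  exact N.received_le_of_dist_le hκ hD h

lemma relInterference_le (hκ : 0 < κ) {s b : V × V} (hb : b ∈ N.E) {D : ℝ} (hD : 0 < D)
    (h : N.length b ≤ D * dist (N.loc s.1) (N.loc b.2)) :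
    N.relInterference s b ≤ ENNReal.ofReal (D ^ κ) := by
  by_cases hs : s = b
  · simp [hs, relInterference_self]
  rw [relInterference_of_ne N hs, ENNReal.div_le_iff
    (N.received_ne_zero hκ _ _) (N.received_link_ne_top hb)]
  exact N.received_le_of_dist_le hκ hD h

lemma affectness_mono {S T : Finset (V × V)} (h : S ⊆ T) (l : V × V) :
    N.affectness S l ≤ N.affectness T l := by
  unfold affectness
  gcongr

lemma affectness_eq_sum (S : Finset (V × V)) (l : V × V) :
    N.affectness S l = ∑ l' ∈ S, ENNReal.ofReal (N.noiseFactor l) * N.relInterference l' l :=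
  Finset.mul_sum _ _ _

/-- With received power `r` and interference `I`, the SINR condition `σ (I + ξ) ≤ r` is `σ I / (r -
σ ξ) ≤ 1`, whose left side is the affectness. -/
lemma affectness_le_one_of_isISL (hκ : 0 < κ) (hσ : 0 < σ) {S : Finset (V × V)} (hS : N.IsISL S)
    {l : V × V} (hl : l ∈ S) : N.affectness S l ≤ 1 := by
  classical
  have hlE := hS.1 hl
  have hsinr := hS.2 l hl
  have hlen := N.length_pos hlE
  have hP := N.P_pos
  have hη := N.η_pos
  have hξ := N.ξ_pos
  set r : ℝ := N.P * N.η * N.length l ^ (-κ) with hr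
  have hr0 : 0 < r := by positivity
  have hrec : N.received l.1 l.2 = ENNReal.ofReal r := N.received_eq_ofReal hlen
  have hnoise : σ * N.ξ < r := N.noise_lt_received hκ hσ hlE
  have hsum : ∑ l' ∈ S, N.relInterference l' l =
      (∑ l' ∈ S.erase l, N.received l'.1 l.2) / ENNReal.ofReal r := by
    rw [← Finset.add_sum_erase S _ hl, relInterference_self, zero_add, div_eq_mul_inv, Finset.sum_mul]
    refine Finset.sum_congr rfl fun x hx => ?_
    rw [N.relInterference_of_ne (Finset.ne_of_mem_erase hx), hrec, div_eq_mul_inv]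
  rw [affectness, hsum]
  have h1 : ENNReal.ofReal σ ≤
      ENNReal.ofReal r / (∑ l' ∈ S.erase l, N.received l'.1 l.2 + ENNReal.ofReal N.ξ) := by
    rw [← hrec]
    convert hsinr using 2
    unfold sinr
    congr!
  generalize (∑ l' ∈ S.erase l, N.received l'.1 l.2) = I at h1 ⊢
  -- Infinite interference would make the SINR zero, below `σ`.
  have hI : I ≠ ⊤ := by
    rintro rfl
    simp at h1
    linarith
  lift I to NNReal using hI
  rw [ENNReal.le_div_iff_mul_le (Or.inl (by simp [hξ])) (Or.inl (by simp)),
    ← ENNReal.ofReal_coe_nnreal, ← ENNReal.ofReal_add (by positivity) hξ.le,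
    ← ENNReal.ofReal_mul hσ.le, ENNReal.ofReal_le_ofReal_iff hr0.le] at h1
  rw [← ENNReal.ofReal_coe_nnreal, ← ENNReal.ofReal_div_of_pos hr0,
    ← ENNReal.ofReal_mul (hσ.le.trans (N.le_noiseFactor hκ hσ hlE)), ENNReal.ofReal_le_one,
    noiseFactor, ← hr]
  have h2 : 0 < r - σ * N.ξ := by linarith
  have : σ / (1 - σ * N.ξ / r) * ((I : ℝ) / r) = σ * I / (r - σ * N.ξ) := by
    field_simp
  rw [this, div_le_one h2]
  linarith

/-- Few links of a set of links of bounded affectness can have senders near a receiver. -/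
lemma card_le_of_dist_le (hκ : 0 < κ) (hσ : 0 < σ) {T : Finset (V × V)} {b : V × V} (hb : b ∈ N.E)
    (hT : N.affectness T b ≤ 1) {D : ℝ} (hD : 0 < D)
    (h : ∀ s ∈ T, dist (N.loc s.1) (N.loc b.2) ≤ D * N.length b) :
    (T.card : ℝ) ≤ 1 + D ^ κ / N.noiseFactor b := by
  classical
  have hc := hσ.trans_le (N.le_noiseFactor hκ hσ hb)
  have hDκ : 0 < D ^ κ := Real.rpow_pos_of_pos hD _
  -- Each sender within `D * N.length b` of the receiver contributes at least `c_b / D ^ κ` to an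
  -- affectness of at most `1`.
  have h1 : ((T.erase b).card : ℝ≥0∞) * ENNReal.ofReal (N.noiseFactor b) ≤
      ENNReal.ofReal (D ^ κ) := by
    calc ((T.erase b).card : ℝ≥0∞) * ENNReal.ofReal (N.noiseFactor b)
        = ∑ s ∈ T.erase b, ENNReal.ofReal (N.noiseFactor b) * 1 := by simp
      _ ≤ ∑ s ∈ T.erase b, ENNReal.ofReal (N.noiseFactor b) *
            (ENNReal.ofReal (D ^ κ) * N.relInterference s b) := by
          refine Finset.sum_le_sum fun s hs => ?_
          gcongr
          exact N.one_le_relInterference hκ hb (Finset.ne_of_mem_erase hs) hD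
            (h s (Finset.mem_of_mem_erase hs))
      _ = ENNReal.ofReal (D ^ κ) * N.affectness (T.erase b) b := by
          rw [affectness_eq_sum, Finset.mul_sum]
          exact Finset.sum_congr rfl fun s _ => by ring
      _ ≤ ENNReal.ofReal (D ^ κ) * 1 := by
          gcongr
          exact (N.affectness_mono (Finset.erase_subset _ _) b).trans hT
      _ = _ := mul_one _
  rw [← ENNReal.ofReal_natCast, ← ENNReal.ofReal_mul (by positivity),
    ENNReal.ofReal_le_ofReal_iff hDκ.le] at h1
  have h2 : (T.card : ℝ) ≤ 1 + (T.erase b).card := by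
    have := Finset.pred_card_le_card_erase (s := T) (a := b)
    have h3 : T.card ≤ 1 + (T.erase b).card := by omega
    exact_mod_cast h3
  refine h2.trans ?_
  gcongr
  rwa [le_div_iff₀ hc]

/-- A bound for the number of links, of a set of affectness at most `1`, that are at least as long as
a given link and have their senders within its exclusion radius. -/
def nearBound (κ σ : ℝ) : ℝ := 1 + (3 * (1 / σ) ^ (1 / κ) + 2 * (2 * packingSum κ) ^ (1 / κ)) ^ κ

/-- Any `b ∈ T` sees all senders of `T` within `(3 + 2 e) * N.length b` of its receiver, where `e`
is the excess factor of `a`. Although `e` is unbounded, `e ^ κ` is proportional to `c_a`, and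
dividing by `c_b ≥ c_a` leaves a constant. -/
lemma card_near_le (hκ : 2 < κ) (hσ : 0 < σ) {T : Finset (V × V)} (hTE : T ⊆ N.E)
    (hT : ∀ b ∈ T, N.affectness T b ≤ 1) {a : V × V} (ha : a ∈ N.E)
    (hlen : ∀ b ∈ T, N.length a ≤ N.length b)
    (hdist : ∀ b ∈ T, dist (N.loc b.1) (N.loc a.1) ≤ N.exclusionRadius a) :
    (T.card : ℝ) ≤ nearBound κ σ := by
  have hκ0 : 0 < κ := by linarith
  have hZ := packingSum_pos hκ
  have hc := hσ.trans_le (N.le_noiseFactor hκ0 hσ ha)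
  have he := N.excessFactor_pos hκ hσ ha
  have hB : 0 < 3 * (1 / σ) ^ (1 / κ) + 2 * (2 * packingSum κ) ^ (1 / κ) := by positivity
  rcases T.eq_empty_or_nonempty with rfl | ⟨b, hb⟩
  · simp only [Finset.card_empty, Nat.cast_zero, nearBound]
    positivity
  have hbE := hTE hb
  have h1 := N.card_le_of_dist_le hκ0 hσ hbE (hT b hb) (D := 3 + 2 * N.excessFactor a)
    (by positivity) (fun s hs => by
      have e1 := hdist s hs
      have e2 := hdist b hb
      rw [exclusionRadius_eq] at e1 e2
      have e3 := hlen b hb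
      have t1 := dist_triangle (N.loc s.1) (N.loc b.1) (N.loc b.2)
      have t2 := dist_triangle_right (N.loc s.1) (N.loc b.1) (N.loc a.1)
      have e4 : (1 + N.excessFactor a) * N.length a ≤ (1 + N.excessFactor a) * N.length b := by
        gcongr
      change dist (N.loc s.1) (N.loc b.2) ≤ _
      have e5 : dist (N.loc b.1) (N.loc b.2) = N.length b := rfl
      linarith)
  refine h1.trans ?_
  rw [nearBound]
  gcongr
  rw [div_le_iff₀ (hσ.trans_le (N.le_noiseFactor hκ0 hσ hbE))]
  have hcb := N.noiseFactor_mono hκ0 hσ ha hbE (hlen b hb)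
  have h2 : 3 + 2 * N.excessFactor a ≤
      (3 * (1 / σ) ^ (1 / κ) + 2 * (2 * packingSum κ) ^ (1 / κ)) *
        N.noiseFactor a ^ (1 / κ) := by
    have e1 : N.excessFactor a = (2 * packingSum κ) ^ (1 / κ) * N.noiseFactor a ^ (1 / κ) := by
      rw [excessFactor, ← Real.mul_rpow (by positivity) hc.le]
      congr 1; ring
    -- The bound `σ ≤ c_a` lets the additive `3` be absorbed into a multiple of `c_a ^ (1 / κ)`.
    have e2 : 1 ≤ (1 / σ) ^ (1 / κ) * N.noiseFactor a ^ (1 / κ) := by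
      rw [← Real.mul_rpow (by positivity) hc.le]
      apply Real.one_le_rpow _ (by positivity)
      rw [one_div, inv_mul_eq_div, one_le_div hσ]
      exact N.le_noiseFactor hκ0 hσ ha
    rw [e1]
    nlinarith
  calc (3 + 2 * N.excessFactor a) ^ κ ≤ ((3 * (1 / σ) ^ (1 / κ) +
        2 * (2 * packingSum κ) ^ (1 / κ)) * N.noiseFactor a ^ (1 / κ)) ^ κ :=
        Real.rpow_le_rpow (by positivity) h2 hκ0.le
    _ = (3 * (1 / σ) ^ (1 / κ) + 2 * (2 * packingSum κ) ^ (1 / κ)) ^ κ * N.noiseFactor a := by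
        rw [Real.mul_rpow hB.le (by positivity), one_div κ, Real.rpow_inv_rpow hc.le hκ0.ne']
    _ ≤ _ := by gcongr

/-! ### Links protected by guards -/

/-- Each `o ∈ O` removes from `B` the links whose receivers are too close to its sender, and then
the `M` links with senders nearest to it, its guards. For a surviving `b`, a guard is at most `3`
times as far from the receiver of `b` as `o` is, so it interferes at least `3 ^ (-κ)` times as much.
-/
lemma exists_guarded_subset (hκ : 2 < κ) (hσ : 0 < σ) {S : Finset (V × V)} (hSE : S ⊆ N.E)
    (hS : ∀ b ∈ S, N.affectness S b ≤ 1) [DecidableEq (V × V)] (M : ℕ) (O : Finset (V × V)) :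
    ∃ B ⊆ S, ((S \ B).card : ℝ) ≤ (1 + 3 ^ κ / σ + M) * O.card ∧
      ∀ b ∈ B, M * ∑ o ∈ O, N.relInterference o b ≤
        ENNReal.ofReal (3 ^ κ) * ∑ s ∈ S \ B, N.relInterference s b := by
  have hκ0 : 0 < κ := by linarith
  induction O using Finset.induction_on with
  | empty => exact ⟨S, subset_rfl, by simp⟩
  | insert o O ho ih =>
    obtain ⟨B, hBS, hcard, hB⟩ := ih
    set close := B.filter fun b => dist (N.loc o.1) (N.loc b.2) < N.length b with hclose
    have hcloseS : close ⊆ S := (Finset.filter_subset _ _).trans hBS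
    have hclose_card : (close.card : ℝ) ≤ 1 + 3 ^ κ / σ := by
      rcases close.eq_empty_or_nonempty with h | h
      · rw [h]; simp; positivity
      -- At the receiver of the longest close link, every close sender is within three times its
      -- length, via the receiver of that sender and the sender of `o`.
      · obtain ⟨b, hb, hmax⟩ := close.exists_max_image N.length h
        have hbE := hSE (hcloseS hb)
        refine (N.card_le_of_dist_le hκ0 hσ hbE ((N.affectness_mono hcloseS b).trans
          (hS b (hcloseS hb))) (D := 3) (by norm_num) fun s hs => ?_).trans ?_
        · have h1 := (Finset.mem_filter.1 hs).2
          have h2 := (Finset.mem_filter.1 hb).2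
          have h3 := hmax s hs
          have h4 := dist_triangle (N.loc s.1) (N.loc s.2) (N.loc b.2)
          have h5 := dist_triangle_left (N.loc s.2) (N.loc b.2) (N.loc o.1)
          have h6 : dist (N.loc s.1) (N.loc s.2) = N.length s := rfl
          linarith
        · gcongr
          exact N.le_noiseFactor hκ0 hσ hbE
    have hstep : ∀ g ⊆ B \ close, g.card ≤ M →
        ((S \ ((B \ close) \ g)).card : ℝ) ≤
          (1 + 3 ^ κ / σ + M) * (insert o O).card := by
      intro g hg hgM
      have h1 : S \ ((B \ close) \ g) ⊆ (S \ B) ∪ (close ∪ g) := by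
        intro x
        simp only [Finset.mem_sdiff, Finset.mem_union]
        tauto
      have h2 := (Finset.card_le_card h1).trans ((Finset.card_union_le _ _).trans
        (Nat.add_le_add_left (Finset.card_union_le _ _) _))
      have h3 : ((S \ ((B \ close) \ g)).card : ℝ) ≤
        (S \ B).card + (close.card + g.card) := by exact_mod_cast h2
      have h4 : (g.card : ℝ) ≤ M := by exact_mod_cast hgM
      rw [Finset.card_insert_of_notMem ho]
      push_cast
      linarith
    rcases le_or_gt (B \ close).card M with hM | hM
    -- Too few links remain to supply `M` guards; removing all of them stays within the budget.
    · exact ⟨(B \ close) \ (B \ close), by simp, hstep _ subset_rfl hM, by simp⟩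
    obtain ⟨g, hg, hgM, hnear⟩ := (B \ close).exists_subset_card_eq_forall_le
      (fun s => dist (N.loc s.1) (N.loc o.1)) hM.le
    refine ⟨(B \ close) \ g, Finset.sdiff_subset.trans (Finset.sdiff_subset.trans hBS),
      hstep g hg hgM.le, fun b hb => ?_⟩
    have hb' := hb
    simp only [Finset.mem_sdiff] at hb'
    obtain ⟨⟨hbB, hbc⟩, hbg⟩ := hb'
    have hfar : N.length b ≤ dist (N.loc o.1) (N.loc b.2) := by
      by_contra h
      exact hbc (Finset.mem_filter.2 ⟨hbB, not_le.1 h⟩)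
    have hguard : M * N.relInterference o b ≤
        ENNReal.ofReal (3 ^ κ) * ∑ s ∈ g, N.relInterference s b := by
      calc M * N.relInterference o b = ∑ s ∈ g, N.relInterference o b := by simp [hgM]
        _ ≤ ∑ s ∈ g, ENNReal.ofReal (3 ^ κ) * N.relInterference s b := by
          refine Finset.sum_le_sum fun s hs => ?_
          refine N.relInterference_le_mul hκ0 (ne_of_mem_of_not_mem hs hbg) (by norm_num) ?_
          have h1 := hnear s hs b hb
          have h2 := dist_triangle (N.loc s.1) (N.loc o.1) (N.loc b.2)
          have h3 := dist_triangle_right (N.loc b.1) (N.loc o.1) (N.loc b.2)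
          have h4 : dist (N.loc b.1) (N.loc b.2) = N.length b := rfl
          linarith
        _ = _ := (Finset.mul_sum _ _ _).symm
    -- Guards of different `o` are disjoint, so their interferences add up inside the removed set.
    have hdisj : Disjoint (S \ B) g := by
      rw [Finset.disjoint_left]
      intro x hx hxg
      exact (Finset.mem_sdiff.1 hx).2 (Finset.mem_sdiff.1 (hg hxg)).1
    have hsub : (S \ B) ∪ g ⊆ S \ ((B \ close) \ g) := by
      intro x hx
      rcases Finset.mem_union.1 hx with hx | hx
      · simp only [Finset.mem_sdiff] at hx ⊢
        tauto
      · have := Finset.mem_sdiff.1 (hg hx)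
        simp only [Finset.mem_sdiff]
        exact ⟨hBS this.1, fun h => h.2 hx⟩
    rw [Finset.sum_insert ho, mul_add]
    calc _ ≤ ENNReal.ofReal (3 ^ κ) * ∑ s ∈ g, N.relInterference s b +
          ENNReal.ofReal (3 ^ κ) * ∑ s ∈ S \ B, N.relInterference s b :=
          add_le_add hguard (hB b hbB)
      _ = ENNReal.ofReal (3 ^ κ) * ∑ s ∈ (S \ B) ∪ g, N.relInterference s b := by
          rw [Finset.sum_union hdisj]; ring
      _ ≤ _ := by gcongr

/-- A bound, relative to the number of links in a set `O`, for the number of links in a set of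
affectness at most `1` that are affected by more than `1 / 2` by `O`. -/
def affectedBound (κ σ : ℝ) : ℝ := 1 + 3 ^ κ / σ + ⌈2 * (3 : ℝ) ^ κ⌉₊

/-- With `M ≥ 2 * 3 ^ κ` guards per link of `O`, a survivor would be affected by more than `1` by
the guards. So nothing survives, and all of `S` is counted among the removed links. -/
lemma card_affected_le (hκ : 2 < κ) (hσ : 0 < σ) {S : Finset (V × V)} (hSE : S ⊆ N.E)
    (hS : ∀ b ∈ S, N.affectness S b ≤ 1) (O : Finset (V × V))
    (hO : ∀ b ∈ S, 1 / 2 < N.affectness O b) :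
    (S.card : ℝ) ≤ affectedBound κ σ * O.card := by
  classical
  have h3 : (0 : ℝ) < 3 ^ κ := by positivity
  obtain ⟨B, hBS, hcard, hB⟩ :=
    N.exists_guarded_subset hκ hσ hSE hS ⌈2 * (3 : ℝ) ^ κ⌉₊ O
  rcases B.eq_empty_or_nonempty with rfl | ⟨b, hb⟩
  · simpa [affectedBound] using hcard
  exfalso
  set M := ⌈2 * (3 : ℝ) ^ κ⌉₊
  have hM : 2 * (3 : ℝ) ^ κ ≤ M := Nat.le_ceil _
  have hM0 : M ≠ 0 := by
    rintro h
    rw [h] at hM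
    simp at hM
    linarith
  have h1 : M * N.affectness O b ≤ ENNReal.ofReal (3 ^ κ) := by
    calc M * N.affectness O b = ENNReal.ofReal (N.noiseFactor b) *
          (M * ∑ o ∈ O, N.relInterference o b) := by rw [affectness]; ring
      _ ≤ ENNReal.ofReal (N.noiseFactor b) * (ENNReal.ofReal (3 ^ κ) *
            ∑ s ∈ S \ B, N.relInterference s b) := mul_le_mul_right (hB b hb) _
      _ = ENNReal.ofReal (3 ^ κ) * N.affectness (S \ B) b := by rw [affectness]; ring
      _ ≤ ENNReal.ofReal (3 ^ κ) * 1 := by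
          gcongr
          exact (N.affectness_mono Finset.sdiff_subset b).trans (hS b (hBS hb))
      _ = _ := mul_one _
  have h2 : (M : ℝ≥0∞) * (1 / 2) < M * N.affectness O b :=
    ENNReal.mul_lt_mul_right (by exact_mod_cast hM0) (by simp) (hO b (hBS hb))
  have h4 : ENNReal.ofReal (3 ^ κ) ≤ (M : ℝ≥0∞) * (1 / 2) := by
    have : (M : ℝ≥0∞) * (1 / 2) = ENNReal.ofReal (M * (1 / 2)) := by
      rw [ENNReal.ofReal_mul (by positivity), ENNReal.ofReal_natCast,
        ENNReal.ofReal_div_of_pos (by norm_num)]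
      simp
    rw [this]
    apply ENNReal.ofReal_le_ofReal
    linarith
  exact absurd (h4.trans_lt (h2.trans_le h1)) (lt_irrefl _)

/-! ### Separated senders -/

/-- A bound for the affectness of a link caused by links with separated senders. -/
def separatedBound (κ : ℝ) : ℝ :=
  4 ^ κ / (2 * packingSum κ) * ∑' x : Fin 2 → ℤ, ‖x‖ ^ (-κ)

lemma separatedBound_nonneg (hκ : 2 < κ) : 0 ≤ separatedBound κ := by
  have := packingSum_pos hκ
  have : 0 ≤ ∑' x : Fin 2 → ℤ, ‖x‖ ^ (-κ) := tsum_nonneg fun x => by positivity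
  rw [separatedBound]
  positivity

/-- Lattice points injectively replace the senders, and `∑ ‖x‖ ^ (-κ)` converges on the plane
lattice because `κ > 2`. The bound is independent of `a`, since `c_a` cancels against the power `κ`
of the excess factor. -/
lemma affectness_le_of_separated (hκ : 2 < κ) (hσ : 0 < σ) {a : V × V} (ha : a ∈ N.E)
    (F : Finset (V × V))
    (hFa : ∀ l ∈ F, N.exclusionRadius a < dist (N.loc l.1) (N.loc a.1))
    (hF : ∀ l ∈ F, ∀ l' ∈ F, l ≠ l' → N.exclusionRadius a < dist (N.loc l.1) (N.loc l'.1)) :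
    N.affectness F a ≤ ENNReal.ofReal (separatedBound κ) := by
  have hκ0 : 0 < κ := by linarith
  have ht := N.exclusionRadius_pos hκ hσ ha
  have he := N.excessFactor_pos hκ hσ ha
  have hlen := N.length_pos ha
  have hZ := packingSum_pos hκ
  have hc := hσ.trans_le (N.le_noiseFactor hκ0 hσ ha)
  obtain ⟨x, hinj, hx⟩ := exists_lattice_points_of_separated F (fun l => N.loc l.1) (N.loc a.1) ht
    hFa hF
  have hterm : ∀ l ∈ F, ENNReal.ofReal (N.noiseFactor a) * N.relInterference l a ≤
      ENNReal.ofReal (4 ^ κ / (2 * packingSum κ) * ‖x l‖ ^ (-κ)) := by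
    intro l hl
    obtain ⟨hx0, hxd⟩ := hx l hl
    have hd := hFa l hl
    have h1 : N.relInterference l a ≤
        ENNReal.ofReal ((4 / (N.excessFactor a * ‖x l‖)) ^ κ) := by
      refine N.relInterference_le hκ0 ha (by positivity) ?_
      have h2 := dist_triangle_right (N.loc l.1) (N.loc a.1) (N.loc a.2)
      have h3 : dist (N.loc a.1) (N.loc a.2) = N.length a := rfl
      rw [h3] at h2
      rw [div_mul_eq_mul_div, le_div_iff₀ (by positivity)]
      rw [exclusionRadius_eq] at hxd hd
      set e := N.excessFactor a
      set d := dist (N.loc l.1) (N.loc a.1)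
      -- Equivalent to `(1 + e) * N.length a ≤ d`: passing from the sender to the receiver of `a`
      -- shrinks distances by a factor of at most `(1 + e) / e`.
      have h4 : e * d ≤ (1 + e) * (d - N.length a) := by nlinarith
      have h5 : e * ((1 + e) * N.length a / 4 * ‖x l‖) ≤ e * d := by gcongr
      have h6 : (1 + e) * (d - N.length a) ≤
        (1 + e) * dist (N.loc l.1) (N.loc a.2) := by gcongr; linarith
      have h7 : (1 + e) * (e * N.length a * ‖x l‖) ≤
        (1 + e) * (4 * dist (N.loc l.1) (N.loc a.2)) := by nlinarith
      have h8 := le_of_mul_le_mul_left h7 (by linarith)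
      linarith
    calc ENNReal.ofReal (N.noiseFactor a) * N.relInterference l a
        ≤ ENNReal.ofReal (N.noiseFactor a) *
            ENNReal.ofReal ((4 / (N.excessFactor a * ‖x l‖)) ^ κ) := by gcongr
      _ = _ := by
        rw [← ENNReal.ofReal_mul hc.le, Real.div_rpow (by norm_num) (by positivity),
          Real.mul_rpow he.le hx0.le, N.excessFactor_rpow hκ hσ ha, Real.rpow_neg hx0.le]
        congr 1
        field_simp
  rw [affectness_eq_sum]
  refine (Finset.sum_le_sum hterm).trans ?_
  rw [← ENNReal.ofReal_sum_of_nonneg fun l _ => by positivity]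
  apply ENNReal.ofReal_le_ofReal
  rw [← Finset.mul_sum, separatedBound]
  gcongr
  classical
  rw [← Finset.sum_image (g := x) (f := fun y => ‖y‖ ^ (-κ)) hinj]
  exact (EisensteinSeries.summable_one_div_norm_rpow hκ).sum_le_tsum _ fun y _ => by positivity

/-! ### The greedy algorithm -/

lemma GreedyRun.subset {N : WirelessNetwork κ σ V} {A I O : Finset (V × V)}
    (h : N.GreedyRun A I O) : I ⊆ O ∧ ∀ x ∈ O, x ∈ I ∨ x ∈ A := by
  classical
  induction h with
  | nil I => exact ⟨subset_rfl, fun x hx => Or.inl hx⟩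
  | step A I O a mem _ _ ih =>
    refine ⟨fun x hx => ih.1 (by simp [hx]), fun x hx => ?_⟩
    rcases ih.2 x hx with h | h
    · rcases Finset.mem_insert.1 h with rfl | h
      · exact Or.inr mem
      · exact Or.inl h
    · exact Or.inr (Finset.mem_filter.1 h).1

/-- A discarded link is near a selected link that is at most as long, or it is affected by the
selected links. -/
lemma GreedyRun.near_or_affected {N : WirelessNetwork κ σ V} (hκ : 2 < κ) (hσ : 0 < σ)
    {A I O : Finset (V × V)} (h : N.GreedyRun A I O) (hA : A ⊆ N.E) :
    ∀ b ∈ A, (∃ a ∈ O, a ∈ N.E ∧ N.length a ≤ N.length b ∧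
        dist (N.loc b.1) (N.loc a.1) ≤ N.exclusionRadius a) ∨ 1 / 2 < N.affectness O b := by
  classical
  induction h with
  | nil I => simp
  | step A I O a mem shortest rest ih =>
    intro b hb
    have hO := rest.subset.1
    have ha : a ∈ O := hO (Finset.mem_insert_self a I)
    by_cases h1 : dist (N.loc b.1) (N.loc a.1) ≤ N.exclusionRadius a
    · exact Or.inl ⟨a, ha, hA mem, shortest b hb, h1⟩
    by_cases h2 : N.affectness (insert a I) b ≤ 1 / 2
    · refine ih ((Finset.filter_subset _ _).trans hA) b (Finset.mem_filter.2
        ⟨hb, ?_, not_le.1 h1, ?_⟩)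
      · rintro rfl
        rw [dist_self] at h1
        exact h1 (N.exclusionRadius_pos hκ hσ (hA mem)).le
      · convert h2
    · refine Or.inr ((not_le.1 h2).trans_le (N.affectness_mono ?_ b))
      convert hO

lemma GreedyRun.separated {N : WirelessNetwork κ σ V} {A I O : Finset (V × V)}
    (h : N.GreedyRun A I O) {δ : ℝ} (hδ : ∀ x ∈ A, δ ≤ N.exclusionRadius x) :
    ∀ x ∈ O, x ∉ I → ∀ y ∈ O, y ∉ I → x ≠ y → δ < dist (N.loc x.1) (N.loc y.1) := by
  classical
  induction h with
  | nil I => intro x hx hx'; exact absurd hx hx'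
  | step A I O a mem _ rest ih =>
    have hrest : ∀ y ∈ O, y ∉ I → y ≠ a → δ < dist (N.loc y.1) (N.loc a.1) := by
      intro y hy hyI hya
      rcases rest.subset.2 y hy with h | h
      · simp [hya, hyI] at h
      · exact (hδ a mem).trans_lt (Finset.mem_filter.1 h).2.2.1
    intro x hx hxI y hy hyI hxy
    by_cases hxa : x = a
    · subst hxa
      rw [dist_comm]
      exact hrest y hy hyI (Ne.symm hxy)
    by_cases hya : y = a
    · subst hya
      exact hrest x hx hxI hxy
    exact ih (fun x hx => hδ x (Finset.mem_filter.1 hx).1) x hx (by simp [hxa, hxI]) y hy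
      (by simp [hya, hyI]) hxy

/-- A bound for the affectness of the greedily selected links on each other. -/
def greedyBound (κ : ℝ) : ℝ := 1 / 2 + separatedBound κ

/-- When `l` is selected, surviving so far guarantees affectness at most `1 / 2` from the links
already selected. All later ones are at least as long, hence separated from `l` and from each other
by more than the exclusion radius of `l`. -/
lemma GreedyRun.affectness_le {N : WirelessNetwork κ σ V} (hκ : 2 < κ) (hσ : 0 < σ)
    {A I O : Finset (V × V)} (h : N.GreedyRun A I O) (hA : A ⊆ N.E)
    (hI : ∀ b ∈ A, b ∉ I ∧ N.affectness I b ≤ 1 / 2) :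
    ∀ l ∈ O, l ∉ I → N.affectness O l ≤ ENNReal.ofReal (greedyBound κ) := by
  classical
  induction h with
  | nil I => intro x hx hx'; exact absurd hx hx'
  | step A I O a mem shortest rest ih =>
    intro l hl hlI
    by_cases hla : l = a
    · subst hla
      have hlE := hA mem
      have hO := rest.subset
      have hsep : N.affectness (O \ insert l I) l ≤ ENNReal.ofReal (separatedBound κ) := by
        refine N.affectness_le_of_separated hκ hσ hlE _ ?_ ?_
        · intro x hx
          rw [Finset.mem_sdiff] at hx
          rcases hO.2 x hx.1 with h | h
          · exact absurd (by convert h) hx.2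
          · exact (Finset.mem_filter.1 h).2.2.1
        · intro x hx y hy hxy
          rw [Finset.mem_sdiff] at hx hy
          refine rest.separated (fun z hz => ?_) x hx.1 ?_ y hy.1 ?_ hxy
          · have hz := (Finset.mem_filter.1 hz).1
            exact N.exclusionRadius_mono hκ hσ hlE (hA hz) (shortest z hz)
          · convert hx.2
          · convert hy.2
      have hsplit : N.affectness O l =
          N.affectness (O \ insert l I) l + N.affectness (insert l I) l := by
        simp only [affectness_eq_sum]
        rw [Finset.sum_sdiff]
        convert hO.1
      have hself : N.affectness (insert l I) l = N.affectness I l := by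
        rw [affectness_eq_sum, Finset.sum_insert hlI, relInterference_self, mul_zero, zero_add,
          affectness_eq_sum]
      rw [hsplit, hself, greedyBound, add_comm, ENNReal.ofReal_add (by norm_num)
        (separatedBound_nonneg hκ)]
      refine add_le_add ((hI l mem).2.trans ?_) hsep
      rw [ENNReal.ofReal_div_of_pos (by norm_num)]
      simp
    · refine ih ((Finset.filter_subset _ _).trans hA) (fun b hb => ?_) l hl (by simp [hla, hlI])
      obtain ⟨hbA, hba, _, hb⟩ := Finset.mem_filter.1 hb
      exact ⟨by simp [hba, (hI b hbA).1], hb⟩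

/-- The approximation factor of the greedy algorithm. -/
def greedyFactor (κ σ : ℝ) : ℝ := nearBound κ σ + affectedBound κ σ

lemma greedyFactor_pos (hκ : 2 < κ) (hσ : 0 < σ) : 0 < greedyFactor κ σ := by
  have := packingSum_pos hκ
  rw [greedyFactor, nearBound, affectedBound]
  positivity

lemma GreedyRun.card_le {N : WirelessNetwork κ σ V} (hκ : 2 < κ) (hσ : 0 < σ)
    {A O : Finset (V × V)} (h : N.GreedyRun A ∅ O) (hA : A ⊆ N.E) {T : Finset (V × V)}
    (hTA : T ⊆ A) (hT : ∀ b ∈ T, N.affectness T b ≤ 1) :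
    (T.card : ℝ) ≤ greedyFactor κ σ * O.card := by
  classical
  have hmono : ∀ T' ⊆ T, ∀ b ∈ T', N.affectness T' b ≤ 1 := fun T' hT' b hb =>
    (N.affectness_mono hT' b).trans (hT b (hT' hb))
  set near : V × V → Finset (V × V) := fun a => T.filter fun b => a ∈ N.E ∧
    N.length a ≤ N.length b ∧ dist (N.loc b.1) (N.loc a.1) ≤ N.exclusionRadius a with hnear
  set aff := T.filter fun b => 1 / 2 < N.affectness O b with haff
  have hcover : T ⊆ O.biUnion near ∪ aff := by
    intro b hb
    rw [Finset.mem_union, Finset.mem_biUnion]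
    rcases h.near_or_affected hκ hσ hA b (hTA hb) with ⟨a, ha, h⟩ | h
    · exact Or.inl ⟨a, ha, Finset.mem_filter.2 ⟨hb, h⟩⟩
    · exact Or.inr (Finset.mem_filter.2 ⟨hb, h⟩)
  have h1 : (T.card : ℝ) ≤ ∑ a ∈ O, ((near a).card : ℝ) + aff.card := by
    have := (Finset.card_le_card hcover).trans ((Finset.card_union_le _ _).trans
      (Nat.add_le_add_right Finset.card_biUnion_le _))
    exact_mod_cast this
  have h2 : ∀ a ∈ O, ((near a).card : ℝ) ≤ nearBound κ σ := by
    intro a ha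
    have haE : a ∈ N.E := (h.subset.2 a ha).elim (by simp) fun h => hA h
    exact N.card_near_le hκ hσ ((Finset.filter_subset _ _).trans (hTA.trans hA))
      (hmono _ (Finset.filter_subset _ _)) haE (fun b hb => (Finset.mem_filter.1 hb).2.2.1)
      (fun b hb => (Finset.mem_filter.1 hb).2.2.2)
  have h3 := N.card_affected_le hκ hσ ((Finset.filter_subset _ _).trans (hTA.trans hA))
      (hmono aff (Finset.filter_subset _ _)) O (fun b hb => (Finset.mem_filter.1 hb).2)
  have h4 := Finset.sum_le_card_nsmul _ _ _ h2
  rw [nsmul_eq_mul] at h4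
  rw [greedyFactor]
  linarith

/-! ### First-fit -/

lemma sum_firstFitInsert_le (τ : ℝ≥0∞) (l : V × V) (f : V × V → ℝ≥0∞)
    (Bs : List (Finset (V × V))) :
    ((N.firstFitInsert τ l Bs).map fun B => ∑ x ∈ B, f x).sum ≤
      (Bs.map fun B => ∑ x ∈ B, f x).sum + f l := by
  classical
  induction Bs with
  | nil => simp [firstFitInsert]
  | cons B Bs ih =>
    rw [firstFitInsert]
    split_ifs
    · have h : ∑ x ∈ insert l B, f x ≤ f l + ∑ x ∈ B, f x := by
        by_cases hl : l ∈ B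
        · rw [Finset.insert_eq_of_mem hl]; exact le_add_self
        · rw [Finset.sum_insert hl]
      simp only [List.map_cons, List.sum_cons]
      calc _ ≤ (f l + ∑ x ∈ B, f x) + (Bs.map fun B => ∑ x ∈ B, f x).sum := by
            gcongr
        _ = _ := by ring
    · simp only [List.map_cons, List.sum_cons, add_assoc]
      gcongr

lemma mem_firstFitInsert (τ : ℝ≥0∞) (l x : V × V) (Bs : List (Finset (V × V)))
    (hx : x = l ∨ ∃ B ∈ Bs, x ∈ B) : ∃ B ∈ N.firstFitInsert τ l Bs, x ∈ B := by
  classical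
  induction Bs with
  | nil => simpa [firstFitInsert] using hx
  | cons B Bs ih =>
    rw [firstFitInsert]
    split_ifs
    · rcases hx with rfl | ⟨B', hB', hx⟩
      · exact ⟨_, List.mem_cons_self, by simp⟩
      · rcases List.mem_cons.1 hB' with rfl | hB'
        · exact ⟨_, List.mem_cons_self, by simp [hx]⟩
        · exact ⟨B', by simp [hB'], hx⟩
    · rcases hx with rfl | ⟨B', hB', hx⟩
      · obtain ⟨B', hB', h⟩ := ih (Or.inl rfl)
        exact ⟨B', by simp [hB'], h⟩
      · rcases List.mem_cons.1 hB' with rfl | hB'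
        · exact ⟨_, List.mem_cons_self, hx⟩
        · obtain ⟨B'', hB'', h⟩ := ih (Or.inr ⟨B', hB', hx⟩)
          exact ⟨B'', by simp [hB''], h⟩

/-- A new class is opened only if every existing one affects `l` by more than `τ`. -/
lemma length_firstFitInsert (τ : ℝ≥0∞) (l : V × V) (Bs : List (Finset (V × V))) :
    (N.firstFitInsert τ l Bs).length = Bs.length ∨
      ((N.firstFitInsert τ l Bs).length = Bs.length + 1 ∧
        Bs.length * τ ≤ (Bs.map fun B => N.affectness B l).sum) := by
  classical
  induction Bs with
  | nil => simp [firstFitInsert]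
  | cons B Bs ih =>
    rw [firstFitInsert]
    split_ifs with h
    · simp
    · rcases ih with ih | ⟨ih, ih'⟩
      · simp [ih]
      · refine Or.inr ⟨by simp [ih], ?_⟩
        simp only [List.length_cons, Nat.cast_add, Nat.cast_one, List.map_cons, List.sum_cons]
        rw [add_mul, one_mul, add_comm]
        exact add_le_add (not_le.1 h).le ih'

lemma firstFit_append_singleton (τ : ℝ≥0∞) (L : List (V × V)) (l : V × V) :
    N.firstFit τ (L ++ [l]) = N.firstFitInsert τ l (N.firstFit τ L) := by
  simp [firstFit]

lemma sum_firstFit_le (τ : ℝ≥0∞) (L : List (V × V)) (f : V × V → ℝ≥0∞) :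
    ((N.firstFit τ L).map fun B => ∑ x ∈ B, f x).sum ≤ (L.map f).sum := by
  induction L using List.reverseRecOn with
  | nil => simp [firstFit]
  | append_singleton L l ih =>
    rw [firstFit_append_singleton, List.map_append, List.sum_append, List.map_singleton,
      List.sum_singleton]
    exact (N.sum_firstFitInsert_le τ l f _).trans (by gcongr)

lemma mem_firstFit (τ : ℝ≥0∞) (L : List (V × V)) {x : V × V} (hx : x ∈ L) :
    ∃ B ∈ N.firstFit τ L, x ∈ B := by
  induction L using List.reverseRecOn with
  | nil => simp at hx
  | append_singleton L l ih =>
    rw [firstFit_append_singleton]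
    apply mem_firstFitInsert
    rcases List.mem_append.1 hx with h | h
    · exact Or.inr (ih h)
    · exact Or.inl (List.mem_singleton.1 h)

/-- When the last class is opened, each earlier class affects the new link by at least `τ`, while
together they affect it by at most `α`. The class just opened accounts for the extra `τ`. -/
lemma length_firstFit_mul_le (τ : ℝ≥0∞) (L : List (V × V)) {α : ℝ≥0∞}
    (hL : ∀ l ∈ L, (L.map fun l' => ENNReal.ofReal (N.noiseFactor l) *
      N.relInterference l' l).sum ≤ α) :
    (N.firstFit τ L).length * τ ≤ α + τ := by
  induction L using List.reverseRecOn with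
  | nil => simp [firstFit]
  | append_singleton L l ih =>
    have hpre : ∀ x ∈ L ++ [l], (L.map fun l' => ENNReal.ofReal (N.noiseFactor x) *
        N.relInterference l' x).sum ≤ α := fun x hx => by
      refine le_trans ?_ (hL x hx)
      rw [List.map_append, List.sum_append]
      exact le_self_add
    rw [firstFit_append_singleton]
    rcases N.length_firstFitInsert τ l (N.firstFit τ L) with h | ⟨h, h'⟩
    · rw [h]
      exact ih fun x hx => hpre x (List.mem_append_left _ hx)
    · rw [h]
      push_cast
      rw [add_mul, one_mul]
      gcongr
      refine h'.trans ?_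
      simp only [affectness_eq_sum]
      exact (N.sum_firstFit_le τ L _).trans (hpre l (by simp))

lemma length_firstFit_le {ε : ℝ} (hε : 0 < ε) (hε1 : ε < 1) {X : Finset (V × V)} {A : ℝ}
    (hA : 0 ≤ A) (hX : ∀ l ∈ X, N.affectness X l ≤ ENNReal.ofReal A) {L : List (V × V)}
    (hL : L.Nodup) (hLX : ∀ l ∈ L, l ∈ X) :
    ((N.firstFit (ENNReal.ofReal ((1 - ε) / 2)) L).length : ℝ) ≤ (2 * A + 1) / (1 - ε) := by
  classical
  have h := N.length_firstFit_mul_le (ENNReal.ofReal ((1 - ε) / 2)) L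
    (α := ENNReal.ofReal A) fun l hl => by
      refine le_trans ?_ (hX l (hLX l hl))
      rw [← List.sum_toFinset _ hL, affectness_eq_sum]
      exact Finset.sum_le_sum_of_subset fun x hx => hLX x (List.mem_toFinset.1 hx)
  have h0 : 0 < 1 - ε := by linarith
  rw [← ENNReal.ofReal_natCast, ← ENNReal.ofReal_mul (by positivity),
    ← ENNReal.ofReal_add hA (by positivity), ENNReal.ofReal_le_ofReal_iff (by positivity)] at h
  -- Relaxing `2 * A + (1 - ε)` to `2 * A + 1` makes the numerator independent of `ε`.
  rw [le_div_iff₀ h0]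
  linarith

lemma length_refine_le {ε : ℝ} (hε : 0 < ε) (hε1 : ε < 1) {X : Finset (V × V)} {A : ℝ}
    (hA : 0 ≤ A) (hX : ∀ l ∈ X, N.affectness X l ≤ ENNReal.ofReal A) {L : List (V × V)}
    (hL : L.Nodup) (hLX : ∀ l ∈ L, l ∈ X) :
    ((N.refine ε L).length : ℝ) ≤ ((2 * A + 1) / (1 - ε)) ^ 2 := by
  classical
  have h0 : 0 < 1 - ε := by linarith
  have hfirst := N.length_firstFit_le hε hε1 hA hX hL hLX
  rw [refine, List.length_flatMap, Nat.cast_list_sum, List.map_map]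
  refine (List.sum_le_card_nsmul _ ((2 * A + 1) / (1 - ε)) ?_).trans ?_
  · intro x hx
    obtain ⟨B, -, rfl⟩ := List.mem_map.1 hx
    refine N.length_firstFit_le hε hε1 hA hX ((List.nodup_reverse.2 hL).filter _) fun l hl => ?_
    exact hLX l (List.mem_reverse.1 (List.mem_filter.1 hl).1)
  · rw [List.length_map, nsmul_eq_mul, sq]
    gcongr

lemma mem_refine (ε : ℝ) {L : List (V × V)} {x : V × V} (hx : x ∈ L) :
    ∃ B ∈ N.refine ε L, x ∈ B := by
  classical
  obtain ⟨B, hB, hxB⟩ := N.mem_firstFit (ENNReal.ofReal ((1 - ε) / 2)) L hx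
  obtain ⟨B', hB', hxB'⟩ := N.mem_firstFit (ENNReal.ofReal ((1 - ε) / 2))
    (L.reverse.filter fun l => l ∈ B) (x := x) (by simp [hx, hxB])
  refine ⟨B', List.mem_flatMap.2 ⟨B, hB, ?_⟩, hxB'⟩
  convert hB'

/-! ### Weights of covers, and the loss caused by refinement. -/

lemma weight_mono {Q : V × V → ℝ} (hQ : ∀ l, 0 ≤ Q l) {S T : Finset (V × V)} (h : S ⊆ T) :
    weight Q S ≤ weight Q T :=
  Finset.sum_le_sum_of_subset_of_nonneg h fun l _ _ => hQ l

lemma weight_nonneg {Q : V × V → ℝ} (hQ : ∀ l, 0 ≤ Q l) (S : Finset (V × V)) : 0 ≤ weight Q S :=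
  Finset.sum_nonneg fun l _ => hQ l

lemma weight_le_sum_of_cover {Q : V × V → ℝ} (hQ : ∀ l, 0 ≤ Q l) (Bs : List (Finset (V × V)))
    (S : Finset (V × V)) (h : ∀ l ∈ S, ∃ B ∈ Bs, l ∈ B) :
    weight Q S ≤ (Bs.map (weight Q)).sum := by
  classical
  induction Bs generalizing S with
  | nil =>
    have : S = ∅ := Finset.eq_empty_of_forall_notMem fun l hl => by simpa using h l hl
    simp [this, weight]
  | cons B Bs ih =>
    rw [List.map_cons, List.sum_cons]
    have h1 := ih (S \ B) fun l hl => by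
      rw [Finset.mem_sdiff] at hl
      obtain ⟨B', hB', hlB'⟩ := h l hl.1
      rcases List.mem_cons.1 hB' with rfl | hB'
      · exact absurd hlB' hl.2
      · exact ⟨B', hB', hlB'⟩
    have h2 : weight Q (S ∩ B) ≤ weight Q B := weight_mono hQ Finset.inter_subset_right
    have h3 : weight Q (S ∩ B) + weight Q (S \ B) = weight Q S :=
      Finset.sum_inter_add_sum_sdiff S B Q
    linarith

lemma weight_le_of_refine {ε : ℝ} (hε : 0 < ε) (hε1 : ε < 1) {Q : V × V → ℝ}
    (hQ : ∀ l, 0 ≤ Q l) {X₀ X : Finset (V × V)} {A : ℝ} (hA : 0 ≤ A)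
    (hX₀ : ∀ l ∈ X₀, N.affectness X₀ l ≤ ENNReal.ofReal A) {L : List (V × V)}
    (hL : L.Nodup) (hLX : ∀ l, l ∈ L ↔ l ∈ X₀)
    (hX : ∀ Y ∈ N.refine ε L, weight Q Y ≤ weight Q X) :
    weight Q X₀ ≤ ((2 * A + 1) / (1 - ε)) ^ 2 * weight Q X := by
  have h1 := weight_le_sum_of_cover hQ (N.refine ε L) X₀ fun l hl =>
    N.mem_refine ε ((hLX l).2 hl)
  have h2 : ((N.refine ε L).map (weight Q)).sum ≤ (N.refine ε L).length * weight Q X := by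
    have := List.sum_le_card_nsmul ((N.refine ε L).map (weight Q)) (weight Q X) (by simpa using hX)
    simpa using this
  have hlen := N.length_refine_le hε hε1 hA hX₀ hL fun l hl => (hLX l).1 hl
  exact h1.trans (h2.trans (mul_le_mul_of_nonneg_right hlen (weight_nonneg hQ X)))

/-! ### Weight groups -/

/-- Remaining weights lie between `w / n` and `w > 0`, so `2 ^ k ≤ n` for the index `k` of the group
of `l`. -/
lemma exists_mem_weightGroup {Q : V × V → ℝ} {A : Finset (V × V)} (hw : 0 < sSup (Q '' A))
    {l : V × V} (hl : l ∈ heavyLinks Q A) :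
    ∃ k < Nat.log 2 A.card + 1, l ∈ weightGroup Q A k := by
  have hlA : l ∈ A := (Finset.mem_filter.1 hl).1
  have hn : 0 < A.card := Finset.card_pos.2 ⟨l, hlA⟩
  set w := sSup (Q '' A)
  set m := sInf (Q '' heavyLinks Q A) with hm
  have hfin : (Q '' (heavyLinks Q A : Set (V × V))).Finite := (Finset.finite_toSet _).image _
  obtain ⟨l', hl', hQl'⟩ : m ∈ Q '' (heavyLinks Q A : Set (V × V)) :=
    Set.Nonempty.csInf_mem ⟨Q l, Set.mem_image_of_mem Q hl⟩ hfin
  have hwm : w / A.card ≤ m := hQl' ▸ (Finset.mem_filter.1 hl').2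
  have hm0 : 0 < m := (by positivity : 0 < w / A.card).trans_le hwm
  have hmQ : m ≤ Q l := csInf_le hfin.bddBelow (Set.mem_image_of_mem Q hl)
  have hQw : Q l ≤ w :=
    le_csSup ((Finset.finite_toSet _).image _).bddAbove (Set.mem_image_of_mem Q hlA)
  obtain ⟨k, hk, hk'⟩ := exists_nat_pow_near ((one_le_div hm0).2 hmQ) (one_lt_two (α := ℝ))
  rw [le_div_iff₀ hm0] at hk
  rw [div_lt_iff₀ hm0] at hk'
  refine ⟨k, ?_, Finset.mem_filter.2 ⟨hl, hk, hk'⟩⟩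
  rw [div_le_iff₀ (by positivity)] at hwm
  have h1 : (2 : ℝ) ^ k * m ≤ A.card * m := by linarith
  have h2 : (2 : ℝ) ^ k ≤ A.card := le_of_mul_le_mul_right h1 hm0
  exact Nat.lt_succ_of_le (Nat.le_log_of_pow_le one_lt_two (by exact_mod_cast h2))

lemma weight_le_of_subset_weightGroup (hκ : 2 < κ) (hσ : 0 < σ) {Q : V × V → ℝ}
    (hQ : ∀ l, 0 ≤ Q l) {A : Finset (V × V)} (hA : A ⊆ N.E) {k : ℕ} {O : Finset (V × V)}
    (hO : N.GreedyRun (weightGroup Q A k) ∅ O) {T : Finset (V × V)} (hT : T ⊆ weightGroup Q A k)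
    (haff : ∀ b ∈ T, N.affectness T b ≤ 1) :
    weight Q T ≤ 2 * greedyFactor κ σ * weight Q O := by
  have hsub : weightGroup Q A k ⊆ N.E :=
    (Finset.filter_subset _ _).trans ((Finset.filter_subset _ _).trans hA)
  have hcard := hO.card_le hκ hσ hsub hT haff
  have hF := greedyFactor_pos hκ hσ
  have hm : 0 ≤ sInf (Q '' heavyLinks Q A) := Real.sInf_nonneg fun x hx => by
    obtain ⟨l, -, rfl⟩ := hx
    exact hQ l
  set m := sInf (Q '' heavyLinks Q A)
  have h1 : weight Q T ≤ T.card * (2 ^ (k + 1) * m) := by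
    rw [← nsmul_eq_mul]
    exact Finset.sum_le_card_nsmul _ _ _ fun l hl => (Finset.mem_filter.1 (hT hl)).2.2.le
  have h2 : O.card * (2 ^ k * m) ≤ weight Q O := by
    rw [← nsmul_eq_mul]
    refine Finset.card_nsmul_le_sum _ _ _ fun l hl => ?_
    exact (Finset.mem_filter.1 ((hO.subset.2 l hl).resolve_left (by simp))).2.1
  calc weight Q T ≤ T.card * (2 ^ (k + 1) * m) := h1
    _ ≤ (greedyFactor κ σ * O.card) * (2 ^ (k + 1) * m) := by gcongr
    _ = 2 * greedyFactor κ σ * (O.card * (2 ^ k * m)) := by ring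
    _ ≤ _ := by gcongr

/-- The cover of `T` consists of `Nat.log 2 A.card + 1` groups and one part for the light links,
each of weight at most `2 * greedyFactor κ σ * weight Q X`. -/
lemma weight_le_of_isGroupedISL (hκ : 2 < κ) (hσ : 0 < σ) {Q : V × V → ℝ} (hQ : ∀ l, 0 ≤ Q l)
    {A X : Finset (V × V)} (hA : A ⊆ N.E) (hX : N.IsGroupedISL Q A X) {T : Finset (V × V)}
    (hT : T ⊆ A) (haff : ∀ b ∈ T, N.affectness T b ≤ 1) :
    weight Q T ≤ 2 * greedyFactor κ σ * (Nat.log 2 A.card + 2) * weight Q X := by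
  classical
  obtain ⟨O, hO, k₀, rfl, hmax⟩ := hX
  have hF := greedyFactor_pos hκ hσ
  have hX0 := weight_nonneg hQ (O k₀)
  have hgroup : ∀ k, ∀ T' ⊆ weightGroup Q A k, (∀ b ∈ T', N.affectness T' b ≤ 1) →
      weight Q T' ≤ 2 * greedyFactor κ σ * weight Q (O k₀) := fun k T' hT' h' =>
    (N.weight_le_of_subset_weightGroup hκ hσ hQ hA (hO k) hT' h').trans
      (by gcongr; exact hmax k)
  have hfin : (Q '' (A : Set (V × V))).Finite := (Finset.finite_toSet _).image _
  rcases le_or_gt (sSup (Q '' A)) 0 with hw | hw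
  · have : weight Q T ≤ 0 := Finset.sum_nonpos fun l hl =>
      (le_csSup hfin.bddAbove (Set.mem_image_of_mem Q (hT hl))).trans hw
    exact this.trans (by positivity)
  have hne : (A : Set (V × V)).Nonempty := by
    by_contra h
    rw [Set.not_nonempty_iff_eq_empty] at h
    rw [h, Set.image_empty, Real.sSup_empty] at hw
    exact lt_irrefl _ hw
  have hn : 1 ≤ A.card := Finset.card_pos.2 hne
  obtain ⟨l₀, hl₀, hQl₀⟩ := Set.Nonempty.csSup_mem (hne.image Q) hfin
  set w := sSup (Q '' A)
  have hl₀H : l₀ ∈ heavyLinks Q A := by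
    refine Finset.mem_filter.2 ⟨hl₀, ?_⟩
    rw [hQl₀]
    exact div_le_self hw.le (by exact_mod_cast hn)
  -- A heaviest link alone has affectness `0` and lies in some group, so the group estimate applies
  -- to it; `w` in turn bounds the at most `n` light links of weight at most `w / n`.
  have hw_le : w ≤ 2 * greedyFactor κ σ * weight Q (O k₀) := by
    obtain ⟨k, -, hk⟩ := exists_mem_weightGroup hw hl₀H
    have := hgroup k {l₀} (by simpa using hk) (by simp [affectness, relInterference_self])
    simpa [weight, hQl₀] using this
  set light := T.filter fun l => l ∉ heavyLinks Q A with hlight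
  have hlight_le : weight Q light ≤ w := by
    have h1 : ∀ l ∈ light, Q l ≤ w / A.card := by
      intro l hl
      rw [hlight, Finset.mem_filter] at hl
      by_contra h
      exact hl.2 (Finset.mem_filter.2 ⟨hT hl.1, (not_le.1 h).le⟩)
    have h2 : (light.card : ℝ) ≤ A.card := by
      exact_mod_cast Finset.card_le_card ((Finset.filter_subset _ _).trans hT)
    calc weight Q light ≤ light.card • (w / A.card) := Finset.sum_le_card_nsmul _ _ _ h1
      _ = light.card * (w / A.card) := nsmul_eq_mul _ _
      _ ≤ A.card * (w / A.card) := by gcongr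
      _ = w := by field_simp
  set part : ℕ → Finset (V × V) := fun k => T.filter fun l => l ∈ weightGroup Q A k with hpart
  have hpart_le : ∀ k, weight Q (part k) ≤ 2 * greedyFactor κ σ * weight Q (O k₀) := fun k =>
    hgroup k _ (fun l hl => (Finset.mem_filter.1 hl).2) fun b hb =>
      (N.affectness_mono (Finset.filter_subset _ _) b).trans (haff b (Finset.mem_filter.1 hb).1)
  have hcover := weight_le_sum_of_cover hQ
    (light :: (List.range (Nat.log 2 A.card + 1)).map part) T fun l hl => by
      by_cases hlH : l ∈ heavyLinks Q A
      · obtain ⟨k, hk, hlk⟩ := exists_mem_weightGroup hw hlH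
        exact ⟨part k, List.mem_cons_of_mem _ (List.mem_map_of_mem (List.mem_range.2 hk)),
          Finset.mem_filter.2 ⟨hl, hlk⟩⟩
      · exact ⟨light, List.mem_cons_self, Finset.mem_filter.2 ⟨hl, hlH⟩⟩
  have hsum := List.sum_le_card_nsmul
    (((light :: (List.range (Nat.log 2 A.card + 1)).map part)).map (weight Q))
    (2 * greedyFactor κ σ * weight Q (O k₀)) fun x hx => by
      obtain ⟨B, hB, rfl⟩ := List.mem_map.1 hx
      rcases List.mem_cons.1 hB with rfl | hB
      · exact hlight_le.trans hw_le
      · obtain ⟨k, -, rfl⟩ := List.mem_map.1 hB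
        exact hpart_le k
  refine (hcover.trans hsum).trans_eq ?_
  simp only [List.length_map, List.length_cons, List.length_range, nsmul_eq_mul]
  push_cast
  ring

lemma IsGroupedISL.affectness_le {N : WirelessNetwork κ σ V} (hκ : 2 < κ) (hσ : 0 < σ)
    {Q : V × V → ℝ} {A X : Finset (V × V)} (hX : N.IsGroupedISL Q A X) (hA : A ⊆ N.E) :
    ∀ l ∈ X, N.affectness X l ≤ ENNReal.ofReal (greedyBound κ) := by
  obtain ⟨O, hO, k, rfl, -⟩ := hX
  have hsub : weightGroup Q A k ⊆ N.E :=
    (Finset.filter_subset _ _).trans ((Finset.filter_subset _ _).trans hA)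
  exact fun l hl => (hO k).affectness_le hκ hσ hsub (fun b _ => by simp [affectness]) l hl (by simp)

/-- There are at most `|V| ^ 2` links, which gives `2 log |V| / log 2`; the summand `2` is at most
the same quantity because `|V| ≥ 2`. -/
lemma log_card_links_le [Fintype V] {A : Finset (V × V)} (hV : 2 ≤ Fintype.card V)
    (hA : A.Nonempty) :
    (Nat.log 2 A.card : ℝ) + 2 ≤ 4 / Real.log 2 * Real.log (Fintype.card V) := by
  have h2 : 0 < Real.log 2 := Real.log_pos (by norm_num)
  have hcard : (A.card : ℝ) ≤ (Fintype.card V : ℝ) ^ 2 := by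
    have := Finset.card_le_univ A
    rw [Fintype.card_prod, ← sq] at this
    exact_mod_cast this
  have h0 : (0 : ℝ) < A.card := by exact_mod_cast hA.card_pos
  have h1 : (Nat.log 2 A.card : ℝ) ≤ 2 * Real.log (Fintype.card V) / Real.log 2 := by
    refine (Real.natLog_le_logb _ _).trans ?_
    rw [Real.logb, Nat.cast_ofNat]
    gcongr
    have := Real.log_le_log h0 hcard
    rwa [Real.log_pow, Nat.cast_ofNat] at this
  have h3 : 1 ≤ Real.log (Fintype.card V) / Real.log 2 := by
    rw [one_le_div h2]
    exact Real.log_le_log (by norm_num) (by exact_mod_cast hV)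
  calc (Nat.log 2 A.card : ℝ) + 2 ≤ 2 * Real.log (Fintype.card V) / Real.log 2 +
        2 * (Real.log (Fintype.card V) / Real.log 2) := by linarith
    _ = _ := by ring

end WirelessNetwork

end

/-! ### Combining the three losses. -/

theorem lemma7 (κ σ : ℝ) (hκ : 2 < κ) (hσ : 0 < σ) :
    ∃ C : ℝ, 0 < C ∧
      ∀ (V : Type*) [Fintype V] (N : WirelessNetwork κ σ V) (ε : ℝ) (_ : 0 < ε) (_ : ε < 1)
        (J M K a b : ℕ) (_ : K = 2 * M + J) (_ : a < K) (_ : b < K) (i j : ℤ)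
        (Q : V × V → ℝ) (_ : ∀ l, 0 ≤ Q l)
        (Sopt X : Finset (V × V)) (_ : N.IsMWISL Q Sopt)
        (_ : N.IsLocalSchedule Q ε (N.localLinks K M a b i j) X),
        (1 - ε) ^ 2 / (4 * (C * Real.log (Fintype.card V))) *
            WirelessNetwork.weight Q (N.localPart K M a b i j Sopt)
          ≤ WirelessNetwork.weight Q X := by
  classical
  have hF := WirelessNetwork.greedyFactor_pos hκ hσ
  have hA : 0 ≤ WirelessNetwork.greedyBound κ :=
    add_nonneg (by norm_num) (WirelessNetwork.separatedBound_nonneg hκ)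
  have hlog2 : 0 < Real.log 2 := Real.log_pos (by norm_num)
  -- The remaining factor `4` of the claim comes from `log_card_links_le`, and `(1 - ε) ^ 2` from
  -- the two first-fit passes.
  refine ⟨2 * WirelessNetwork.greedyFactor κ σ * (2 * WirelessNetwork.greedyBound κ + 1) ^ 2 /
    Real.log 2, by positivity, ?_⟩
  intro V _ N ε hε hε1 J M K a b _ _ _ i j Q hQ Sopt X hSopt hX
  set F := WirelessNetwork.greedyFactor κ σ
  set A := WirelessNetwork.greedyBound κ
  have hLE : N.localLinks K M a b i j ⊆ N.E := Finset.filter_subset _ _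
  set T := N.localPart K M a b i j Sopt with hTdef
  have hTS : T ⊆ Sopt := Finset.inter_subset_left
  have hTL : T ⊆ N.localLinks K M a b i j := Finset.inter_subset_right
  -- A link has positive length and hence two distinct ends, so outside the empty case `log |V|` is
  -- positive.
  rcases T.eq_empty_or_nonempty with hT | ⟨l, hl⟩
  · rw [hT]
    simpa [WirelessNetwork.weight] using WirelessNetwork.weight_nonneg hQ X
  have hV : 2 ≤ Fintype.card V := by
    have hlen := N.length_pos (hLE (hTL hl))
    have hne : l.1 ≠ l.2 := fun h => by simp [WirelessNetwork.length, h] at hlen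
    exact Fintype.one_lt_card_iff.2 ⟨_, _, hne⟩
  obtain ⟨X₀, L, hX₀, hL, hLX, -, hmax⟩ := hX
  have hκ0 : 0 < κ := by linarith
  have haff : ∀ b ∈ T, N.affectness T b ≤ 1 := fun b hb =>
    (N.affectness_mono hTS b).trans (N.affectness_le_one_of_isISL hκ0 hσ hSopt.1 (hTS hb))
  have h1 := N.weight_le_of_isGroupedISL hκ hσ hQ hLE hX₀ hTL haff
  have h2 := N.weight_le_of_refine hε hε1 hQ hA (hX₀.affectness_le hκ hσ hLE) hL hLX
    fun Y hY => hmax Y (List.mem_cons_of_mem _ hY)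
  have h3 := WirelessNetwork.log_card_links_le hV ⟨l, hTL hl⟩
  have hlogV : 0 < Real.log (Fintype.card V) := Real.log_pos (by exact_mod_cast hV)
  have hε0 : 0 < 1 - ε := by linarith
  have hWX := WirelessNetwork.weight_nonneg hQ X
  have hWX₀ := WirelessNetwork.weight_nonneg hQ X₀
  have h4 : WirelessNetwork.weight Q T ≤ 2 * F * (4 / Real.log 2 * Real.log (Fintype.card V)) *
      (((2 * A + 1) / (1 - ε)) ^ 2 * WirelessNetwork.weight Q X) :=
    h1.trans (by gcongr)
  rw [div_mul_eq_mul_div, div_le_iff₀ (by positivity)]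
  calc (1 - ε) ^ 2 * WirelessNetwork.weight Q T ≤ (1 - ε) ^ 2 *
        (2 * F * (4 / Real.log 2 * Real.log (Fintype.card V)) *
          (((2 * A + 1) / (1 - ε)) ^ 2 * WirelessNetwork.weight Q X)) := by gcongr
    _ = _ := by field_simp
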